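/- Let $\Delta$ be a finite set of pairwise commuting derivations (acting on all differential rings below); all rings are commutative with identity. For a differential ring $R$, let $\operatorname{Spec}^\Delta R$ be the set of prime ideals of $R$ stable under $\Delta$, with the topology induced by the Zariski topology of $\operatorname{Spec} R$. Let $A\subseteq B$ be an extension of differential rings that are $\mathbb{Q}$-algebras (differential Ritt algebras), such that $B$ is an integral domain and is differentially finitely generated over $A$, i.e. $B$ is generated as an $A$-algebra by finitely many elements together with all their iterated derivatives. Suppose that $\operatorname{Spec}^\Delta A$ is a noetherian topological space. Then there exists a nonzero element $s\in B$ such that the contraction map $\operatorname{Spec}^\Delta B_s\to \operatorname{Spec}^\Delta A$, $\mathfrak q\mapsto \mathfrak q\cap A$ (the preimage of $\mathfrak q$ under $A\to B_s$), is open, where $B_s$ is the localization of $B$ at the powers of $s$, with the derivations extended by the quotient rule. -/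

import Mathlib

/-- A structure of differential ring on the commutative ring `R`: a family of pairwise commuting
derivations of `R`, indexed by `Δ`. (The set `Δ` is taken finite in the theorem.) -/
class DeltaRing (Δ : Type*) (R : Type*) [CommRing R] where
  der : Δ → Derivation ℤ R R
  der_comm : ∀ (i j : Δ) (x : R), der i (der j x) = der j (der i x)

/-- A ring homomorphism is differential if it commutes with all the derivations in `Δ`. -/
def IsDeltaHom (Δ : Type*) {R S : Type*} [CommRing R] [CommRing S] [DeltaRing Δ R] [DeltaRing Δ S]
    (f : R →+* S) : Prop :=
  ∀ (i : Δ) (x : R), f (DeltaRing.der i x) = DeltaRing.der i (f x)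

theorem IsDeltaHom.comp {Δ R S T : Type*} [CommRing R] [CommRing S] [CommRing T]
    [DeltaRing Δ R] [DeltaRing Δ S] [DeltaRing Δ T] {g : S →+* T} {f : R →+* S}
    (hg : IsDeltaHom Δ g) (hf : IsDeltaHom Δ f) : IsDeltaHom Δ (g.comp f) := fun i x => by
  rw [RingHom.comp_apply, RingHom.comp_apply, hf i x, hg i (f x)]

/-- An ideal is differential if it is stable under all the derivations in `Δ`. -/
def IsDeltaIdeal (Δ : Type*) {R : Type*} [CommRing R] [DeltaRing Δ R] (I : Ideal R) : Prop :=
  ∀ (i : Δ) (x : R), x ∈ I → DeltaRing.der i x ∈ I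

/-- The differential spectrum: the prime differential ideals of `R`, with the Zariski topology,
that is, the topology induced from the prime spectrum of `R`. -/
abbrev DeltaSpec (Δ : Type*) (R : Type*) [CommRing R] [DeltaRing Δ R] : Type _ :=
  {p : PrimeSpectrum R // IsDeltaIdeal Δ p.asIdeal}

/-- The map of differential spectra `q ↦ f⁻¹(q)` given by a differential homomorphism `f`. -/
def DeltaSpec.comap {Δ R S : Type*} [CommRing R] [CommRing S] [DeltaRing Δ R] [DeltaRing Δ S]
    (f : R →+* S) (hf : IsDeltaHom Δ f) (q : DeltaSpec Δ S) : DeltaSpec Δ R :=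
  ⟨PrimeSpectrum.comap f q.1, fun i x hx => by
    have h : f x ∈ q.1.asIdeal := hx
    change f (DeltaRing.der i x) ∈ q.1.asIdeal
    rw [hf i x]
    exact q.2 i _ h⟩

/-- The differential `A`-subalgebra of `B` generated by `t`: the smallest `A`-subalgebra that
contains `t` and is stable under all the derivations in `Δ`. -/
def deltaAdjoin (Δ : Type*) (A : Type*) {B : Type*} [CommRing A] [CommRing B] [Algebra A B]
    [DeltaRing Δ B] (t : Set B) : Subalgebra A B :=
  sInf {S : Subalgebra A B | t ⊆ S ∧ ∀ (i : Δ) (x : B), x ∈ S → DeltaRing.der i x ∈ S}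

/-- `B` is differentially finitely generated over `A`. -/
def DeltaFiniteType (Δ : Type*) (A B : Type*) [CommRing A] [CommRing B] [Algebra A B]
    [DeltaRing Δ B] : Prop :=
  ∃ t : Finset B, deltaAdjoin Δ A (t : Set B) = ⊤

namespace DeltaLocalization

variable {R : Type*} [CommRing R] (M : Submonoid R) (L : Type*) [CommRing L] [Algebra R L]
  [IsLocalization M L] (D : Derivation ℤ R R)

/-- The ring homomorphism `x ↦ x + D(x) ε` from `R` to the dual numbers over `L`. -/
def toDual {R : Type*} [CommRing R] (L : Type*) [CommRing L] [Algebra R L]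
    (D : Derivation ℤ R R) : R →+* TrivSqZeroExt L L where
  toFun x := TrivSqZeroExt.inl (algebraMap R L x) + TrivSqZeroExt.inr (algebraMap R L (D x))
  map_one' := by ext <;> simp
  map_zero' := by ext <;> simp
  map_add' x y := by ext <;> simp [Algebra.smul_def (A := L)]
  map_mul' x y := by ext <;> simp [Algebra.smul_def (A := L), mul_comm]

theorem isUnit_toDual (m : M) : IsUnit (toDual L D m) :=
  TrivSqZeroExt.isUnit_iff_isUnit_fst.2 (by
    simpa [toDual] using IsLocalization.map_units L m)

/-- The extension of `toDual` to the localization `L = M⁻¹R`; its `ε`-part is the derivation that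
extends `D`. -/
noncomputable def lift : L →+* TrivSqZeroExt L L :=
  IsLocalization.lift (isUnit_toDual M L D)

theorem lift_algebraMap (x : R) : lift M L D (algebraMap R L x) = toDual L D x :=
  IsLocalization.lift_eq _ _

theorem fst_lift (x : L) : (lift M L D x).fst = x := by
  have h : (TrivSqZeroExt.fstHom ℤ L L).toRingHom.comp (lift M L D) = RingHom.id _ := by
    refine IsLocalization.ringHom_ext M (RingHom.ext fun r => ?_)
    change (lift M L D (algebraMap R L r)).fst = algebraMap R L r
    rw [lift_algebraMap]
    simp [toDual]
  exact RingHom.congr_fun h x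

/-- The derivation of `L = M⁻¹R` that extends the derivation `D` of `R`. -/
noncomputable def der : Derivation ℤ L L :=
  Derivation.mk'
    (AddMonoidHom.toIntLinearMap
      { toFun := fun x => (lift M L D x).snd
        map_zero' := by simp
        map_add' := fun x y => by simp })
    (fun a b => by
      change (lift M L D (a * b)).snd = a • (lift M L D b).snd + b • (lift M L D a).snd
      rw [map_mul, TrivSqZeroExt.snd_mul, fst_lift, fst_lift, op_smul_eq_smul])

theorem der_algebraMap (x : R) : der M L D (algebraMap R L x) = algebraMap R L (D x) := by
  change (lift M L D (algebraMap R L x)).snd = _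
  rw [lift_algebraMap]
  simp [toDual, Algebra.smul_def (A := L)]

/-- Two derivations of `L = M⁻¹R` that agree on the image of `R` are equal. -/
theorem der_ext {R : Type*} [CommRing R] (M : Submonoid R) {L : Type*} [CommRing L] [Algebra R L]
    [IsLocalization M L] {D₁ D₂ : Derivation ℤ L L}
    (h : ∀ x : R, D₁ (algebraMap R L x) = D₂ (algebraMap R L x)) : D₁ = D₂ := by
  ext z
  obtain ⟨x, m, rfl⟩ := IsLocalization.exists_mk'_eq M z
  have hu := IsLocalization.map_units L m
  have e := IsLocalization.mk'_spec L x m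
  have e₁ := congrArg D₁ e
  have e₂ := congrArg D₂ e
  rw [Derivation.leibniz, h, h] at e₁
  rw [Derivation.leibniz, ← e₁] at e₂
  have e₃ := add_left_cancel e₂
  simp only [smul_eq_mul] at e₃
  exact (hu.mul_left_cancel e₃).symm

/-- The structure of differential ring on `L = M⁻¹R` given by the extended derivations. -/
noncomputable abbrev deltaRing (Δ : Type*) [DeltaRing Δ R] : DeltaRing Δ L where
  der i := der M L (DeltaRing.der i)
  der_comm i j x := by
    have h : ⁅der M L (DeltaRing.der i), der M L (DeltaRing.der j)⁆ = 0 :=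
      der_ext M fun r => by
        rw [Derivation.commutator_apply]
        simp only [der_algebraMap, DeltaRing.der_comm i j r, sub_self,
          Derivation.coe_zero, Pi.zero_apply]
    have h' := DFunLike.congr_fun h x
    rw [Derivation.commutator_apply] at h'
    exact sub_eq_zero.1 h'

end DeltaLocalization

/-- The localization `M⁻¹R` of a differential ring, with the derivations extended from `R`. -/
noncomputable instance Localization.instDeltaRing {Δ R : Type*} [CommRing R] [DeltaRing Δ R]
    (M : Submonoid R) : DeltaRing Δ (Localization M) :=
  DeltaLocalization.deltaRing M (Localization M) Δ

theorem isDeltaHom_algebraMap_localization (Δ : Type*) {R : Type*} [CommRing R] [DeltaRing Δ R]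
    (M : Submonoid R) : IsDeltaHom Δ (algebraMap R (Localization M)) := fun i x =>
  (DeltaLocalization.der_algebraMap M (Localization M) (DeltaRing.der i) x).symm

/-!
A prime minimal over a differential ideal of a `ℚ`-algebra is again differential. So if the primes
`q ⊆ B_s` in an open set `V` contract onto an open set `U` of `Spec A`, then shrinking `q` to a
prime minimal over the extension of a differential prime in `U` shows that the differential primes
in `V` contract onto those in `U`. It remains to find `s ≠ 0` such that `Spec B_s → Spec A` is open.

Rank the derivatives of the generators of `B`. Those that are transcendental over the
lower ones form an algebraically independent family; let `P` be the polynomial algebra that they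
generate over `A`. Any other derivative is the leader of an algebraic relation; differentiating a
relation of least degree gives a relation of degree one for each proper derivative of its leader,
with leading coefficient the separant, which is nonzero in characteristic zero. By Dickson's lemma,
finitely many leaders have all leaders among their derivatives. Once their separants are inverted,
`B` is of finite type over `P`. Finally `Spec P → Spec A` is open, and an extension of finite type
of domains is, generator by generator and after localization, either polynomial or finite free.
-/

/-- `Spec S → Spec R` is open on a principal open set `D(t)` with `t ≠ 0`. Openness is phrased
through the open subsets of `D(t)`, rather than through `Spec Sₜ`, so that such maps compose. -/
def GenericallyOpen (R S : Type*) [CommRing R] [CommRing S] [Algebra R S] : Prop :=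
  ∃ t : S, t ≠ 0 ∧ ∀ U : Set (PrimeSpectrum S), IsOpen U → U ⊆ PrimeSpectrum.basicOpen t →
    IsOpen (PrimeSpectrum.comap (algebraMap R S) '' U)

namespace GenericallyOpen

variable {R S T : Type*} [CommRing R] [CommRing S] [CommRing T] [Algebra R S] [Algebra R T]

theorem of_isOpenMap [Nontrivial S] (h : IsOpenMap (PrimeSpectrum.comap (algebraMap R S))) :
    GenericallyOpen R S :=
  ⟨1, one_ne_zero, fun U hU _ => h U hU⟩

theorem trans [Algebra S T] [IsScalarTower R S T] [IsDomain T]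
    (hST : Function.Injective (algebraMap S T))
    (h₁ : GenericallyOpen R S) (h₂ : GenericallyOpen S T) : GenericallyOpen R T := by
  obtain ⟨t, ht, h₁⟩ := h₁
  obtain ⟨u, hu, h₂⟩ := h₂
  refine ⟨u * algebraMap S T t, mul_ne_zero hu ((map_ne_zero_iff _ hST).2 ht), fun U hU hs => ?_⟩
  rw [IsScalarTower.algebraMap_eq R S T, PrimeSpectrum.comap_comp, Set.image_comp]
  refine h₁ _ (h₂ U hU (hs.trans (PrimeSpectrum.basicOpen_mul_le_left _ _))) ?_
  rintro _ ⟨q, hq, rfl⟩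
  exact PrimeSpectrum.basicOpen_mul_le_right u (algebraMap S T t) (hs hq)

theorem of_algEquiv (e : S ≃ₐ[R] T) (h : GenericallyOpen R S) : GenericallyOpen R T := by
  obtain ⟨t, ht, h⟩ := h
  refine ⟨e t, (map_ne_zero_iff _ e.injective).2 ht, fun U hU hs => ?_⟩
  rw [← e.toAlgHom.comp_algebraMap, PrimeSpectrum.comap_comp, Set.image_comp]
  refine h _ ((PrimeSpectrum.homeomorphOfRingEquiv e.toRingEquiv).symm.isOpenMap U hU) ?_
  rintro _ ⟨q, hq, rfl⟩
  exact hs hq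

theorem of_isLocalizationAway [IsDomain S] [Algebra S T] [IsScalarTower R S T] {s : S}
    (hs : s ≠ 0) [IsLocalization.Away s T] (h : GenericallyOpen R T) : GenericallyOpen R S := by
  obtain ⟨d, hd, h⟩ := h
  obtain ⟨b, m, rfl⟩ := IsLocalization.exists_mk'_eq (Submonoid.powers s) d
  have hb : b ≠ 0 := by
    rintro rfl
    exact hd (IsLocalization.mk'_zero m)
  refine ⟨s * b, mul_ne_zero hs hb, fun U hU hUsb => ?_⟩
  have hUs : U ⊆ Set.range (PrimeSpectrum.comap (algebraMap S T)) := by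
    rw [PrimeSpectrum.localization_away_comap_range T s]
    exact hUsb.trans (PrimeSpectrum.basicOpen_mul_le_left s b)
  rw [← Set.image_preimage_eq_of_subset hUs, ← Set.image_comp, ← PrimeSpectrum.comap_comp,
    ← IsScalarTower.algebraMap_eq]
  refine h _ (hU.preimage (PrimeSpectrum.continuous_comap _)) fun q hq => ?_
  have hbq : algebraMap S T b ∉ q.asIdeal := PrimeSpectrum.basicOpen_mul_le_right s b (hUsb hq)
  rw [← IsLocalization.mk'_spec T b m] at hbq
  exact fun hmem => hbq (Ideal.mul_mem_right _ _ hmem)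

theorem exists_isOpenMap_comap_localizationAway (h : GenericallyOpen R S) :
    ∃ s : S, s ≠ 0 ∧ IsOpenMap (PrimeSpectrum.comap
      ((algebraMap S (Localization.Away s)).comp (algebraMap R S))) := by
  obtain ⟨s, hs, h⟩ := h
  refine ⟨s, hs, fun U hU => ?_⟩
  rw [PrimeSpectrum.comap_comp, Set.image_comp]
  refine h _ ((PrimeSpectrum.localization_away_isOpenEmbedding _ s).isOpenMap U hU) ?_
  rw [← PrimeSpectrum.localization_away_comap_range (Localization.Away s) s]
  exact Set.image_subset_range _ _

end GenericallyOpen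

theorem adjoin_image_algebraMap_eq_top {R S K L : Type*} [CommRing R] [CommRing S]
    [CommRing K] [CommRing L] [Algebra R S] [Algebra R K] [Algebra S L] [Algebra K L] [Algebra R L]
    [IsScalarTower R K L] [IsScalarTower R S L] (M : Submonoid R) [IsLocalization M K]
    [IsLocalization (Algebra.algebraMapSubmonoid S M) L] {X : Set S}
    (hX : Algebra.adjoin R X = ⊤) : Algebra.adjoin K (algebraMap S L '' X) = ⊤ := by
  let T : Subalgebra K L := Algebra.adjoin K (algebraMap S L '' X)
  have hST (s : S) : algebraMap S L s ∈ T := by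
    have hle : Algebra.adjoin R X ≤
        (T.restrictScalars R).comap (IsScalarTower.toAlgHom R S L) :=
      Algebra.adjoin_le fun y hy => Algebra.subset_adjoin (Set.mem_image_of_mem _ hy)
    exact hle (hX ▸ Algebra.mem_top)
  refine Algebra.eq_top_iff.2 fun z => ?_
  obtain ⟨s, ⟨_, m, hm, rfl⟩, rfl⟩ :=
    IsLocalization.exists_mk'_eq (Algebra.algebraMapSubmonoid S M) z
  have hz : IsLocalization.mk' L s
      ⟨algebraMap R S m, Algebra.mem_algebraMapSubmonoid_of_mem ⟨m, hm⟩⟩ =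
      algebraMap K L (IsLocalization.mk' K 1 ⟨m, hm⟩) * algebraMap S L s := by
    rw [IsLocalization.mk'_eq_iff_eq_mul, mul_right_comm, ← IsScalarTower.algebraMap_apply,
      IsScalarTower.algebraMap_apply R K L, ← map_mul, IsLocalization.mk'_spec, map_one, map_one,
      one_mul]
  rw [hz]
  exact T.mul_mem (T.algebraMap_mem _) (hST s)

section LeastDegreeRelation

open Polynomial

/-- `p` is a nonzero polynomial of least degree that vanishes at `x`. Over a domain that need not be
integrally closed, this replaces the minimal polynomial over the fraction field. -/
structure IsLeastDegreeRelation {R S : Type*} [CommRing R] [CommRing S] [Algebra R S]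
    (p : R[X]) (x : S) : Prop where
  ne_zero : p ≠ 0
  aeval_eq_zero : aeval x p = 0
  eq_zero_of_natDegree_lt : ∀ q : R[X], q.natDegree < p.natDegree → aeval x q = 0 → q = 0

variable {R S : Type*} [CommRing R] [CommRing S] [Algebra R S] {p : R[X]} {x : S}

theorem exists_isLeastDegreeRelation (hx : IsAlgebraic R x) :
    ∃ p : R[X], IsLeastDegreeRelation p x := by
  obtain ⟨p, ⟨hp, hpx⟩, hmin⟩ := WellFounded.has_min (measure (natDegree (R := R))).wf
    {p | p ≠ 0 ∧ aeval x p = 0} hx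
  exact ⟨p, hp, hpx, fun q hq hqx => by_contra fun hq0 => hmin q ⟨hq0, hqx⟩ hq⟩

namespace IsLeastDegreeRelation

theorem C_mul [IsDomain R] (h : IsLeastDegreeRelation p x) {c : R} (hc : c ≠ 0) :
    IsLeastDegreeRelation (C c * p) x where
  ne_zero := mul_ne_zero (C_ne_zero.2 hc) h.ne_zero
  aeval_eq_zero := by rw [map_mul, h.aeval_eq_zero, mul_zero]
  eq_zero_of_natDegree_lt q hq := h.eq_zero_of_natDegree_lt q (by rwa [natDegree_C_mul hc] at hq)

theorem map_isLocalization [IsDomain R] (h : IsLeastDegreeRelation p x) {M : Submonoid R}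
    (hM : M ≤ nonZeroDivisors R) (K L : Type*) [CommRing K] [CommRing L] [Algebra R K]
    [IsLocalization M K] [Algebra S L] [Algebra K L] [Algebra R L] [IsScalarTower R K L]
    [IsScalarTower R S L] (hSL : Function.Injective (algebraMap S L)) :
    IsLeastDegreeRelation (p.map (algebraMap R K)) (algebraMap S L x) where
  ne_zero := (Polynomial.map_ne_zero_iff (IsLocalization.injective K hM)).2 h.ne_zero
  aeval_eq_zero := by rw [aeval_map_algebraMap, aeval_algebraMap_apply, h.aeval_eq_zero, map_zero]
  eq_zero_of_natDegree_lt q hq hqx := by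
    rw [← IsLocalization.integerNormalization_eq_zero_iff hM]
    refine h.eq_zero_of_natDegree_lt _ ?_ (hSL ?_)
    · rw [natDegree_map_eq_of_injective (IsLocalization.injective K hM)] at hq
      exact (natDegree_le_natDegree
        (degree_mono (IsLocalization.integerNormalization_support M q))).trans_lt hq
    · rw [map_zero, ← aeval_algebraMap_apply]
      exact IsLocalization.integerNormalization_aeval_eq_zero M q hqx

theorem ker_aeval (h : IsLeastDegreeRelation p x) (hp : p.Monic) :
    RingHom.ker (aeval (R := R) x) = Ideal.span {p} := by
  ext q
  rw [RingHom.mem_ker, Ideal.mem_span_singleton]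
  refine ⟨fun hq => ?_, fun ⟨r, hr⟩ => by rw [hr, map_mul, h.aeval_eq_zero, zero_mul]⟩
  rw [← modByMonic_eq_zero_iff_dvd hp]
  obtain hp1 | hp1 := eq_or_ne p 1
  · rw [hp1, modByMonic_one]
  · refine h.eq_zero_of_natDegree_lt _ (natDegree_modByMonic_lt q hp hp1) ?_
    rw [modByMonic_eq_sub_mul_div, map_sub, map_mul, hq, h.aeval_eq_zero, zero_mul, sub_zero]

theorem natDegree_ne_zero (h : IsLeastDegreeRelation p x)
    (hinj : Function.Injective (algebraMap R S)) : p.natDegree ≠ 0 := by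
  intro hdeg
  obtain ⟨c, rfl⟩ := natDegree_eq_zero.1 hdeg
  have hc := h.aeval_eq_zero
  rw [aeval_C, map_eq_zero_iff _ hinj] at hc
  exact h.ne_zero (by rw [hc, C_0])

theorem aeval_derivative_ne_zero [IsAddTorsionFree R] (h : IsLeastDegreeRelation p x)
    (hinj : Function.Injective (algebraMap R S)) : aeval x p.derivative ≠ 0 := fun hx =>
  h.natDegree_ne_zero hinj <| derivative_eq_zero.1 <|
    h.eq_zero_of_natDegree_lt _ (natDegree_derivative_lt (h.natDegree_ne_zero hinj)) hx

theorem finite_and_free (h : IsLeastDegreeRelation p x) (hp : p.Monic)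
    (hgen : Algebra.adjoin R {x} = ⊤) : Module.Finite R S ∧ Module.Free R S := by
  have hadj : IsAdjoinRootMonic S p :=
    { map := aeval x
      map_surjective := by
        rw [← AlgHom.range_eq_top, ← Algebra.adjoin_singleton_eq_range_aeval, hgen]
      ker_map := h.ker_aeval hp
      monic := hp }
  exact ⟨hadj.finite, .of_basis hadj.basis⟩

theorem finite_and_free_localization [IsDomain R] (h : IsLeastDegreeRelation p x)
    (hgen : Algebra.adjoin R {x} = ⊤) (K L : Type*) [CommRing K] [CommRing L] [Algebra R K]
    [IsLocalization.Away p.leadingCoeff K] [Algebra S L]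
    [IsLocalization (Algebra.algebraMapSubmonoid S (Submonoid.powers p.leadingCoeff)) L]
    [Algebra K L] [Algebra R L] [IsScalarTower R K L] [IsScalarTower R S L]
    (hSL : Function.Injective (algebraMap S L)) : Module.Finite K L ∧ Module.Free K L := by
  have hM : Submonoid.powers p.leadingCoeff ≤ nonZeroDivisors R :=
    powers_le_nonZeroDivisors_of_noZeroDivisors (leadingCoeff_ne_zero.2 h.ne_zero)
  have : IsDomain K := IsLocalization.isDomain_of_le_nonZeroDivisors K hM
  have hunit : IsLocalization.Away.invSelf p.leadingCoeff *
      (p.map (algebraMap R K)).leadingCoeff = 1 := by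
    rw [leadingCoeff_map_of_injective (IsLocalization.injective K hM), mul_comm,
      IsLocalization.Away.mul_invSelf]
  have hgen' : Algebra.adjoin K {algebraMap S L x} = ⊤ := by
    rw [← Set.image_singleton]
    exact adjoin_image_algebraMap_eq_top (Submonoid.powers p.leadingCoeff) hgen
  exact ((h.map_isLocalization hM K L hSL).C_mul (left_ne_zero_of_mul_eq_one hunit)).finite_and_free
    (monic_C_mul_of_mul_leadingCoeff_eq_one hunit) hgen'

end IsLeastDegreeRelation

end LeastDegreeRelation

namespace GenericallyOpen

variable {R S T : Type*} [CommRing R] [CommRing S] [CommRing T] [Algebra R S]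

theorem of_isAlgebraic [IsDomain S] (hinj : Function.Injective (algebraMap R S)) {x : S}
    (hx : IsAlgebraic R x) (hgen : Algebra.adjoin R {x} = ⊤) : GenericallyOpen R S := by
  have : IsDomain R := hinj.isDomain
  obtain ⟨p, hp⟩ := exists_isLeastDegreeRelation hx
  have ha : algebraMap R S p.leadingCoeff ≠ 0 :=
    (map_ne_zero_iff _ hinj).2 (Polynomial.leadingCoeff_ne_zero.2 hp.ne_zero)
  let M := Submonoid.powers p.leadingCoeff
  let K := Localization M
  let L := Localization (Algebra.algebraMapSubmonoid S M)
  have : IsLocalization.Away (algebraMap R S p.leadingCoeff) L := by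
    rw [IsLocalization.Away, ← Algebra.algebraMapSubmonoid_powers]
    infer_instance
  have hSL : Function.Injective (algebraMap S L) :=
    IsLocalization.injective L (M := Submonoid.powers (algebraMap R S p.leadingCoeff))
      (powers_le_nonZeroDivisors_of_noZeroDivisors ha)
  have : Nontrivial L := hSL.nontrivial
  have ⟨_, _⟩ := hp.finite_and_free_localization hgen K L hSL
  have : Module.Flat R K := IsLocalization.flat K M
  have : Module.Flat R L := .trans R K L
  have : Algebra.FinitePresentation R K := IsLocalization.Away.finitePresentation p.leadingCoeff
  have : Module.FinitePresentation K L := Module.finitePresentation_of_projective K L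
  have : Algebra.FinitePresentation R L := .trans R K L
  exact .of_isLocalizationAway (T := L) ha
    (.of_isOpenMap PrimeSpectrum.isOpenMap_comap_of_hasGoingDown_of_finitePresentation)

theorem of_transcendental [IsDomain R] {x : S} (hx : Transcendental R x)
    (hgen : Algebra.adjoin R {x} = ⊤) : GenericallyOpen R S := by
  refine .of_algEquiv (AlgEquiv.ofBijective (Polynomial.aeval (R := R) x)
    ⟨transcendental_iff_injective.1 hx, ?_⟩) (.of_isOpenMap Polynomial.isOpenMap_comap_C)
  rw [← AlgHom.range_eq_top, ← Algebra.adjoin_singleton_eq_range_aeval, hgen]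

theorem adjoin_range_of_algebraicIndependent [Nontrivial R] {ι : Type*} {x : ι → S}
    (hx : AlgebraicIndependent R x) : GenericallyOpen R (Algebra.adjoin R (Set.range x)) :=
  .of_algEquiv hx.aevalEquiv (.of_isOpenMap MvPolynomial.isOpenMap_comap_C)

variable [IsDomain S]

theorem adjoin_singleton (hinj : Function.Injective (algebraMap R S)) (x : S) :
    GenericallyOpen R (Algebra.adjoin R {x}) := by
  have : IsDomain R := hinj.isDomain
  let y : Algebra.adjoin R {x} := ⟨x, Algebra.self_mem_adjoin_singleton R x⟩
  have hgen : Algebra.adjoin R {y} = ⊤ := by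
    rw [← Algebra.adjoin_adjoin_coe_preimage]
    congr 1
    ext z
    simp only [y, Set.mem_singleton_iff, Set.mem_preimage, Subtype.ext_iff]
  by_cases hy : IsAlgebraic R y
  · refine .of_isAlgebraic (.of_comp (f := Subtype.val) hinj) hy hgen
  · exact .of_transcendental hy hgen

theorem adjoin_adjoin_singleton {T : Subalgebra R S} (h : GenericallyOpen R T) (x : S) :
    GenericallyOpen R ((Algebra.adjoin T {x}).restrictScalars R) := by
  let U : Subalgebra R S := (Algebra.adjoin T {x}).restrictScalars R
  let : Algebra T U := Subalgebra.algebra (Algebra.adjoin T {x})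
  have : IsScalarTower R T U := .of_algebraMap_eq fun _ => rfl
  have hTU : Function.Injective (algebraMap T U) :=
    .of_comp (f := Subtype.val) Subtype.val_injective
  exact h.trans hTU (adjoin_singleton Subtype.val_injective x)

theorem adjoin_finset (hinj : Function.Injective (algebraMap R S)) (F : Finset S) :
    GenericallyOpen R (Algebra.adjoin R (F : Set S)) := by
  classical
  have : IsDomain R := hinj.isDomain
  induction F using Finset.induction_on with
  | empty =>
    rw [Finset.coe_empty, Algebra.adjoin_empty]
    refine .of_algEquiv (Algebra.botEquivOfInjective hinj).symm (.of_isOpenMap ?_)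
    rw [Algebra.algebraMap_self, PrimeSpectrum.comap_id]
    exact .id
  | insert x F _ ih =>
    rw [Finset.coe_insert, Set.insert_eq, Set.union_comm, Algebra.adjoin_union_eq_adjoin_adjoin]
    exact ih.adjoin_adjoin_singleton x

theorem of_finiteType [Algebra.FiniteType R S] (hinj : Function.Injective (algebraMap R S)) :
    GenericallyOpen R S := by
  obtain ⟨F, hF⟩ := Algebra.FiniteType.out (R := R) (A := S)
  have h := adjoin_finset hinj F
  rw [hF] at h
  exact h.of_algEquiv Subalgebra.topEquiv

end GenericallyOpen

theorem algebraicIndependent_of_transcendental_Iio {ι R S : Type*} [CommRing R] [CommRing S]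
    [Algebra R S] [LinearOrder ι] (hinj : Function.Injective (algebraMap R S)) {x : ι → S}
    (h : ∀ i, Transcendental (Algebra.adjoin R (x '' Set.Iio i)) (x i)) :
    AlgebraicIndependent R x := by
  refine algebraicIndependent_of_finite_type fun t ht => ?_
  lift t to Finset ι using ht
  induction t using Finset.induction_on_max with
  | empty => exact Finset.coe_empty (α := ι) ▸ algebraicIndependent_empty_type_iff.2 hinj
  | insert i t hlt ih =>
    rw [Finset.coe_insert]
    exact AlgebraicIndepOn.insert ih ((h i).of_tower_top_of_subalgebra_le
      (Algebra.adjoin_mono (Set.image_mono hlt)))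

theorem subalgebra_eq_top_of_isLocalizationAway {R S L : Type*} [CommRing R] [CommRing S]
    [CommRing L] [Algebra R L] [Algebra S L] (t : S) [IsLocalization.Away t L]
    {T : Subalgebra R L} (hinv : IsLocalization.Away.invSelf t ∈ T)
    (hS : ∀ s : S, algebraMap S L s ∈ T) : T = ⊤ := by
  refine Algebra.eq_top_iff.2 fun z => ?_
  obtain ⟨n, s, hs⟩ := IsLocalization.Away.surj t z
  have hz : z = algebraMap S L s * IsLocalization.Away.invSelf t ^ n := by
    rw [← hs, mul_assoc, ← mul_pow, IsLocalization.Away.mul_invSelf, one_pow, mul_one]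
  rw [hz]
  exact T.mul_mem (hS s) (T.pow_mem hinv n)

section Derivation

variable {A B : Type*} [CommRing A] [CommRing B] [Algebra A B] {D : Derivation ℤ B B}

theorem derivation_mem_of_mem_adjoin {X : Set B} {T : Subalgebra A B}
    (hA : ∀ a : A, D (algebraMap A B a) ∈ T) (hXT : X ⊆ T) (hX : ∀ x ∈ X, D x ∈ T) {y : B}
    (hy : y ∈ Algebra.adjoin A X) : D y ∈ T := by
  have hle : Algebra.adjoin A X ≤ T := Algebra.adjoin_le hXT
  induction hy using Algebra.adjoin_induction with
  | mem x hx => exact hX x hx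
  | algebraMap r => exact hA r
  | add x y _ _ hx hy => rw [map_add]; exact T.add_mem hx hy
  | mul x y hx' hy' hx hy =>
    rw [D.leibniz]
    exact T.add_mem (T.mul_mem (hle hx') hy) (T.mul_mem (hle hy') hx)

theorem derivation_aeval_sub_mem {T T' : Subalgebra A B} (hT : ∀ y ∈ T, D y ∈ T') {x : B}
    (hx : x ∈ T') (p : Polynomial T) :
    D (Polynomial.aeval x p) - Polynomial.aeval x p.derivative * D x ∈ T' := by
  induction p using Polynomial.induction_on' with
  | add p q hp hq =>
    convert T'.add_mem hp hq using 1
    simp only [map_add]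
    ring
  | monomial n c =>
    have hD : D (Polynomial.aeval x (Polynomial.monomial n c)) -
        Polynomial.aeval x (Polynomial.monomial n c).derivative * D x = x ^ n * D c := by
      simp only [Polynomial.derivative_monomial, Polynomial.aeval_monomial, D.leibniz,
        D.leibniz_pow, smul_eq_mul, nsmul_eq_mul, map_mul, map_natCast, Subalgebra.algebraMap_def,
        Algebra.algebraMap_self_apply]
      ring
    rw [hD]
    exact T'.mul_mem (T'.pow_mem hx n) (hT c c.2)

end Derivation

theorem exists_finset_of_wellQuasiOrdered {α : Type*} {r : α → α → Prop} (hr : WellQuasiOrdered r)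
    (L : Set α) : ∃ F : Finset α, ↑F ⊆ L ∧ ∀ b ∈ L, ∃ a ∈ F, r a b := by
  by_contra! h
  obtain ⟨f, -, hf⟩ := exists_seq_of_forall_finset_exists (· ∈ L) (fun a b => ¬ r a b) h
  obtain ⟨m, n, hmn, hr⟩ := hr f
  exact hf m n hmn hr

section Ranking

variable {Δ A B I : Type*} [CommRing A] [CommRing B] [Algebra A B] [LinearOrder I]

/-- A ranking of a family `u` that is stable under the derivations: its index set carries a linear
order for which the shifts `σ i`, which realise the derivations on the indices, are increasing. -/
structure IsRanking [DeltaRing Δ B] (σ : Δ → I → I) (u : I → B) : Prop where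
  strictMono : ∀ i, StrictMono (σ i)
  lt_shift : ∀ i a, a < σ i a
  apply_shift : ∀ i a, u (σ i a) = DeltaRing.der i (u a)

/-- The `A`-subalgebra generated by the members of the family `u` of rank lower than `a`. -/
abbrev adjoinBelow (A : Type*) [CommRing A] [Algebra A B] (u : I → B) (a : I) : Subalgebra A B :=
  Algebra.adjoin A (u '' Set.Iio a)

/-- The indices whose member in the family `u` satisfies an algebraic relation over the members of
lower rank. In the language of differential algebra, these are the leaders of such relations. -/
def leaders (A : Type*) [CommRing A] [Algebra A B] (u : I → B) : Set I :=
  {a | IsAlgebraic (adjoinBelow A u a) (u a)}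

theorem algebraicIndepOn_compl_leaders (hinj : Function.Injective (algebraMap A B)) (u : I → B) :
    AlgebraicIndepOn A u (leaders A u)ᶜ := by
  refine algebraicIndependent_of_transcendental_Iio hinj fun a =>
    Transcendental.of_tower_top_of_subalgebra_le (Algebra.adjoin_mono ?_) a.2
  rintro _ ⟨b, hb, rfl⟩
  exact ⟨b, hb, rfl⟩

theorem range_le_of_mul_mem_adjoinBelow [WellFoundedLT I] {u : I → B}
    (hgen : Algebra.adjoin A (Set.range u) = ⊤) {L : Type*} [CommRing L] [Algebra A L]
    (f : B →ₐ[A] L) (C : Subalgebra A L)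
    (h : ∀ b, f (u b) ∈ C ∨ ∃ s, s * u b ∈ adjoinBelow A u b ∧ ∃ c ∈ C, c * f s = 1) :
    f.range ≤ C := by
  have hu (b : I) : u b ∈ C.comap f := by
    induction b using WellFoundedLT.induction with | ind b ih => ?_
    obtain hb | ⟨s, hs, c, hc, hcs⟩ := h b
    · exact hb
    have hmem : s * u b ∈ C.comap f := Algebra.adjoin_le (Set.image_subset_iff.2 ih) hs
    have hfu : f (u b) = c * f (s * u b) := by rw [map_mul, ← mul_assoc, hcs, one_mul]
    rw [Subalgebra.mem_comap, hfu]
    exact C.mul_mem hc hmem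
  rintro _ ⟨b, rfl⟩
  have hle : Algebra.adjoin A (Set.range u) ≤ C.comap f :=
    Algebra.adjoin_le (Set.range_subset_iff.2 hu)
  exact hle (hgen ▸ Algebra.mem_top)

theorem finiteType_localizationAway_prod [WellFoundedLT I]
    (hgen : Algebra.adjoin A (Set.range u) = ⊤) {F : Finset I}
    (hF : ∀ b ∈ leaders A u, ∃ a ∈ F, ∃ l : List Δ, l.foldr σ a = b) {s : I → B}
    (hs : ∀ a ∈ F, ∀ l : List Δ, l ≠ [] →
      s a * u (l.foldr σ a) ∈ adjoinBelow A u (l.foldr σ a))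
    {P : Subalgebra A B} (hP : ∀ b ∉ leaders A u, u b ∈ P)
    (L : Type*) [CommRing L] [Algebra B L] [Algebra A L] [IsScalarTower A B L]
    [IsLocalization.Away (∏ a ∈ F, s a) L] : Algebra.FiniteType P L := by
  classical
  let f : B →ₐ[A] L := IsScalarTower.toAlgHom A B L
  have hunit {a : I} (ha : a ∈ F) : IsUnit (f (s a)) :=
    isUnit_of_dvd_unit (map_dvd f (Finset.dvd_prod_of_mem s ha))
      (IsLocalization.Away.algebraMap_isUnit (∏ a ∈ F, s a))
  let G : Finset L := insert (IsLocalization.Away.invSelf (∏ a ∈ F, s a))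
    (F.image (fun a => f (u a)) ∪ F.image (fun a => Ring.inverse (f (s a))))
  let T := Algebra.adjoin P (G : Set L)
  have hT {z : L} (hz : z ∈ G) : z ∈ T := Algebra.subset_adjoin hz
  have hfT : f.range ≤ T.restrictScalars A := by
    refine range_le_of_mul_mem_adjoinBelow hgen f _ fun b => ?_
    by_cases hb : b ∈ leaders A u
    · obtain ⟨a, ha, l, rfl⟩ := hF b hb
      obtain rfl | hl := eq_or_ne l []
      · exact .inl (hT (Finset.mem_insert_of_mem
          (Finset.mem_union_left _ (Finset.mem_image_of_mem _ ha))))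
      · exact .inr ⟨s a, hs a ha l hl, Ring.inverse (f (s a)), hT (Finset.mem_insert_of_mem
          (Finset.mem_union_right _ (Finset.mem_image_of_mem _ ha))),
          Ring.inverse_mul_cancel _ (hunit ha)⟩
    · exact .inl (T.algebraMap_mem ⟨u b, hP b hb⟩)
  exact ⟨G, subalgebra_eq_top_of_isLocalizationAway (∏ a ∈ F, s a)
    (hT (Finset.mem_insert_self _ _)) fun b => hfT ⟨b, rfl⟩⟩

namespace IsRanking

variable [DeltaRing Δ B] {σ : Δ → I → I} {u : I → B}

theorem lt_foldr (hu : IsRanking σ u) {l : List Δ} (hl : l ≠ []) (a : I) : a < l.foldr σ a := by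
  induction l with
  | nil => exact absurd rfl hl
  | cons i l ih =>
    obtain rfl | hl := eq_or_ne l []
    · exact hu.lt_shift i a
    · exact (ih hl).trans (hu.lt_shift i _)

theorem mem_adjoinBelow_shift (hu : IsRanking σ u) (i : Δ) (a : I) :
    u a ∈ adjoinBelow A u (σ i a) :=
  Algebra.subset_adjoin (Set.mem_image_of_mem u (hu.lt_shift i a))

variable [DeltaRing Δ A]

theorem der_mem_adjoin (hu : IsRanking σ u) (hdiff : IsDeltaHom Δ (algebraMap A B)) {i : Δ}
    {X Y : Set I} (hXY : X ⊆ Y) (hσ : Set.MapsTo (σ i) X Y) {y : B}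
    (hy : y ∈ Algebra.adjoin A (u '' X)) : DeltaRing.der i y ∈ Algebra.adjoin A (u '' Y) := by
  refine derivation_mem_of_mem_adjoin (fun a => ?_)
    ((Set.image_mono hXY).trans Algebra.subset_adjoin) ?_ hy
  · rw [← hdiff i a]
    exact Subalgebra.algebraMap_mem _ _
  · rintro _ ⟨a, ha, rfl⟩
    rw [← hu.apply_shift]
    exact Algebra.subset_adjoin (Set.mem_image_of_mem u (hσ ha))

theorem der_mem_adjoinBelow (hu : IsRanking σ u) (hdiff : IsDeltaHom Δ (algebraMap A B)) {i : Δ}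
    {a : I} {y : B} (hy : y ∈ adjoinBelow A u a) :
    DeltaRing.der i y ∈ adjoinBelow A u (σ i a) :=
  hu.der_mem_adjoin hdiff (Set.Iio_subset_Iio (hu.lt_shift i a).le)
    (fun _ hb => hu.strictMono i hb) hy

theorem exists_separant [IsDomain B] [CharZero B] (hu : IsRanking σ u)
    (hdiff : IsDeltaHom Δ (algebraMap A B)) {a : I} (ha : a ∈ leaders A u) :
    ∃ s ∈ Algebra.adjoin A (u '' Set.Iic a), s ≠ 0 ∧
      ∀ i, s * u (σ i a) ∈ adjoinBelow A u (σ i a) := by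
  obtain ⟨p, hp⟩ := exists_isLeastDegreeRelation ha
  refine ⟨Polynomial.aeval (u a) p.derivative, ?_,
    hp.aeval_derivative_ne_zero Subtype.val_injective, fun i => ?_⟩
  · have hle : adjoinBelow A u a ≤ Algebra.adjoin A (u '' Set.Iic a) :=
      Algebra.adjoin_mono (Set.image_mono Set.Iio_subset_Iic_self)
    rw [Polynomial.aeval_eq_sum_range]
    refine Subalgebra.sum_mem _ fun k _ => Subalgebra.mul_mem _ (hle (p.derivative.coeff k).2) ?_
    exact Subalgebra.pow_mem _ (Algebra.subset_adjoin (Set.mem_image_of_mem u Set.self_mem_Iic)) k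
  · have h := derivation_aeval_sub_mem (fun y => hu.der_mem_adjoinBelow hdiff (i := i))
      (hu.mem_adjoinBelow_shift i a) p
    rwa [hp.aeval_eq_zero, map_zero, zero_sub, neg_mem_iff, ← hu.apply_shift] at h

theorem mul_shift_mem_adjoinBelow (hu : IsRanking σ u) (hdiff : IsDeltaHom Δ (algebraMap A B))
    {a b : I} (hab : a < b) {s : B} (hs : s ∈ Algebra.adjoin A (u '' Set.Iic a))
    (hsb : s * u b ∈ adjoinBelow A u b) (i : Δ) : s * u (σ i b) ∈ adjoinBelow A u (σ i b) := by
  have hder := hu.der_mem_adjoinBelow hdiff (i := i) hsb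
  have hs' : DeltaRing.der i s ∈ adjoinBelow A u (σ i b) :=
    hu.der_mem_adjoin hdiff (Set.Iic_subset_Iio.2 (hab.trans (hu.lt_shift i b)))
      (fun _ hc => hu.strictMono i (lt_of_le_of_lt hc hab)) hs
  rw [Derivation.leibniz, ← hu.apply_shift] at hder
  exact (add_mem_cancel_right
    ((adjoinBelow A u (σ i b)).mul_mem (hu.mem_adjoinBelow_shift i b) hs')).1 hder

theorem mul_foldr_mem_adjoinBelow (hu : IsRanking σ u) (hdiff : IsDeltaHom Δ (algebraMap A B))
    {a : I} {s : B} (hs : s ∈ Algebra.adjoin A (u '' Set.Iic a))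
    (hsu : ∀ i, s * u (σ i a) ∈ adjoinBelow A u (σ i a)) {l : List Δ} (hl : l ≠ []) :
    s * u (l.foldr σ a) ∈ adjoinBelow A u (l.foldr σ a) := by
  induction l with
  | nil => exact absurd rfl hl
  | cons i l ih =>
    obtain rfl | hl := eq_or_ne l []
    · exact hsu i
    · exact hu.mul_shift_mem_adjoinBelow hdiff (hu.lt_foldr hl a) hs (ih hl) i

theorem exists_separants [IsDomain B] [CharZero B] (hu : IsRanking σ u)
    (hdiff : IsDeltaHom Δ (algebraMap A B)) : ∃ s : I → B, ∀ a ∈ leaders A u, s a ≠ 0 ∧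
      ∀ l : List Δ, l ≠ [] → s a * u (l.foldr σ a) ∈ adjoinBelow A u (l.foldr σ a) := by
  choose! s hs hs0 hsu using fun a (ha : a ∈ leaders A u) => hu.exists_separant hdiff ha
  exact ⟨s, fun a ha => ⟨hs0 a ha, fun l hl =>
    hu.mul_foldr_mem_adjoinBelow hdiff (hs a ha) (hsu a ha) hl⟩⟩

theorem genericallyOpen [WellFoundedLT I] [IsDomain B] [CharZero B] (hu : IsRanking σ u)
    (hinj : Function.Injective (algebraMap A B)) (hdiff : IsDeltaHom Δ (algebraMap A B))
    (hgen : Algebra.adjoin A (Set.range u) = ⊤)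
    (hσ : WellQuasiOrdered fun a b => ∃ l : List Δ, l.foldr σ a = b) : GenericallyOpen A B := by
  have : IsDomain A := hinj.isDomain
  obtain ⟨F, hF, hF'⟩ := exists_finset_of_wellQuasiOrdered hσ (leaders A u)
  obtain ⟨s, hs⟩ := hu.exists_separants hdiff
  let t := ∏ a ∈ F, s a
  have ht : t ≠ 0 := Finset.prod_ne_zero_iff.2 fun a ha => (hs a (hF ha)).1
  let P := Algebra.adjoin A (u '' (leaders A u)ᶜ)
  let L := Localization.Away t
  have hP : GenericallyOpen A P := by
    have h := GenericallyOpen.adjoin_range_of_algebraicIndependent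
      (algebraicIndepOn_compl_leaders hinj u)
    rwa [← Set.image_eq_range] at h
  have hM : Submonoid.powers t ≤ nonZeroDivisors B :=
    powers_le_nonZeroDivisors_of_noZeroDivisors ht
  have : IsDomain L := IsLocalization.isDomain_of_le_nonZeroDivisors L hM
  have : Algebra.FiniteType P L :=
    finiteType_localizationAway_prod hgen hF' (fun a ha => (hs a (hF ha)).2)
      (fun _ hb => Algebra.subset_adjoin (Set.mem_image_of_mem u hb)) L
  have hPL : GenericallyOpen P L := .of_finiteType <|
    (IsLocalization.injective L hM).comp Subtype.val_injective
  exact hP.trans Subtype.val_injective (.of_isLocalizationAway (T := L) ht hPL)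

end IsRanking

end Ranking


section IteratedDerivatives

variable {Δ : Type*}

instance DeltaRing.leftCommutative_der {R : Type*} [CommRing R] [DeltaRing Δ R] :
    LeftCommutative fun (i : Δ) (x : R) => DeltaRing.der i x :=
  ⟨DeltaRing.der_comm⟩

/-- The iterated derivative `∂^θ x`, for a multi-index `θ`. -/
noncomputable def iteratedDer {R : Type*} [CommRing R] [DeltaRing Δ R] (θ : Δ →₀ ℕ) (x : R) : R :=
  (Finsupp.toMultiset θ).foldr (fun i x => DeltaRing.der i x) x

theorem iteratedDer_zero {R : Type*} [CommRing R] [DeltaRing Δ R] (x : R) :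
    iteratedDer (0 : Δ →₀ ℕ) x = x := by
  rw [iteratedDer, Finsupp.toMultiset_zero, Multiset.foldr_zero]

theorem iteratedDer_add_single {R : Type*} [CommRing R] [DeltaRing Δ R] (θ : Δ →₀ ℕ) (i : Δ)
    (x : R) : iteratedDer (θ + Finsupp.single i 1) x = DeltaRing.der i (iteratedDer θ x) := by
  rw [iteratedDer, Finsupp.toMultiset_add, Finsupp.toMultiset_single, one_smul, add_comm,
    Multiset.singleton_add, Multiset.foldr_cons, iteratedDer]

variable (m : MonomialOrder Δ) {ι : Type*}

/-- The index of the derivative `∂^θ` of the `j`-th member of a family. Derivatives are ranked by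
their multi-indices first, compared in the monomial order `m`. -/
noncomputable def derIndex (p : (Δ →₀ ℕ) × ι) : m.syn ×ₗ ι :=
  toLex (m.toSyn p.1, p.2)

/-- The map on indices of derivatives that corresponds to the derivation `∂_i`. -/
noncomputable def derShift (i : Δ) (a : m.syn ×ₗ ι) : m.syn ×ₗ ι :=
  toLex ((ofLex a).1 + m.toSyn (Finsupp.single i 1), (ofLex a).2)

/-- The iterated derivatives of the members of the family `x`. -/
noncomputable def derFamily {R : Type*} [CommRing R] [DeltaRing Δ R] (x : ι → R)
    (a : m.syn ×ₗ ι) : R :=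
  iteratedDer (m.toSyn.symm (ofLex a).1) (x (ofLex a).2)

theorem derIndex_surjective : Function.Surjective (derIndex m (ι := ι)) := fun a =>
  ⟨(m.toSyn.symm (ofLex a).1, (ofLex a).2),
    congrArg toLex (Prod.ext (m.toSyn.apply_symm_apply _) rfl)⟩

theorem derShift_derIndex (i : Δ) (θ : Δ →₀ ℕ) (j : ι) :
    derShift m i (derIndex m (θ, j)) = derIndex m (θ + Finsupp.single i 1, j) :=
  congrArg toLex (Prod.ext (map_add m.toSyn _ _).symm rfl)

theorem exists_foldr_derShift_eq (θ η : Δ →₀ ℕ) (j : ι) :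
    ∃ l : List Δ, l.foldr (derShift m) (derIndex m (θ, j)) = derIndex m (θ + η, j) := by
  classical
  obtain ⟨s, rfl⟩ := Multiset.toFinsupp.surjective η
  induction s using Multiset.induction_on with
  | empty => exact ⟨[], by rw [map_zero, add_zero, List.foldr_nil]⟩
  | cons i s ih =>
    obtain ⟨l, hl⟩ := ih
    refine ⟨i :: l, ?_⟩
    rw [List.foldr_cons, hl, derShift_derIndex, ← Multiset.singleton_add, map_add,
      Multiset.toFinsupp_singleton, add_assoc, add_comm (Multiset.toFinsupp s)]

theorem wellQuasiOrdered_foldr_derShift [Finite Δ] [Finite ι] :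
    WellQuasiOrdered fun a b : m.syn ×ₗ ι => ∃ l : List Δ, l.foldr (derShift m) a = b := by
  refine (WellQuasiOrdered.prod (wellQuasiOrdered_le (α := Δ →₀ ℕ))
    (Finite.wellQuasiOrdered (@Eq ι))).of_surjective ⟨derIndex m, ?_⟩ (derIndex_surjective m)
  rintro ⟨θ, j⟩ ⟨η, _⟩ ⟨hθη, rfl⟩
  obtain ⟨ζ, rfl⟩ := exists_add_of_le hθη
  exact exists_foldr_derShift_eq m θ ζ j

theorem isRanking_derFamily [LinearOrder ι] {R : Type*} [CommRing R] [DeltaRing Δ R] (x : ι → R) :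
    IsRanking (derShift m) (derFamily m x) where
  strictMono i a b hab := by
    rw [Prod.Lex.lt_iff] at hab ⊢
    obtain hab | ⟨hab, hab'⟩ := hab
    · exact .inl (add_lt_add_left hab _)
    · exact .inr ⟨congrArg (· + m.toSyn (Finsupp.single i 1)) hab, hab'⟩
  lt_shift i a := Prod.Lex.lt_iff.2 <| .inl <| lt_add_of_pos_right _ <|
    m.toSyn_lt_iff_ne_zero.2 <|
      (map_ne_zero_iff _ m.toSyn.injective).2 (Finsupp.single_ne_zero.2 one_ne_zero)
  apply_shift i a := by
    rw [derFamily, derShift, ofLex_toLex, map_add, AddEquiv.symm_apply_apply,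
      iteratedDer_add_single, derFamily]

theorem derFamily_derIndex_zero {R : Type*} [CommRing R] [DeltaRing Δ R] (x : ι → R) (j : ι) :
    derFamily m x (derIndex m (0, j)) = x j := by
  rw [derFamily, derIndex, ofLex_toLex, AddEquiv.symm_apply_apply, iteratedDer_zero]

theorem adjoin_range_derFamily [LinearOrder ι] {A B : Type*} [CommRing A] [CommRing B]
    [DeltaRing Δ A] [DeltaRing Δ B] [Algebra A B] (hdiff : IsDeltaHom Δ (algebraMap A B))
    {x : ι → B} (hx : deltaAdjoin Δ A (Set.range x) = ⊤) :
    Algebra.adjoin A (Set.range (derFamily m x)) = ⊤ := by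
  rw [← top_le_iff, ← hx, ← Set.image_univ (f := derFamily m x)]
  refine sInf_le ⟨?_, fun i y hy => (isRanking_derFamily m x).der_mem_adjoin hdiff subset_rfl
    (Set.mapsTo_univ _ _) hy⟩
  rintro _ ⟨j, rfl⟩
  exact Algebra.subset_adjoin ⟨_, Set.mem_univ _, derFamily_derIndex_zero m x j⟩

end IteratedDerivatives

theorem genericallyOpen_of_deltaFiniteType {Δ A B : Type*} [Finite Δ] [CommRing A] [CommRing B]
    [DeltaRing Δ A] [DeltaRing Δ B] [Algebra A B] [IsDomain B] [CharZero B]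
    (hinj : Function.Injective (algebraMap A B)) (hdiff : IsDeltaHom Δ (algebraMap A B))
    (hfg : DeltaFiniteType Δ A B) : GenericallyOpen A B := by
  obtain ⟨t, ht⟩ := hfg
  obtain ⟨k, ⟨e⟩⟩ := Finite.exists_equiv_fin Δ
  let : LinearOrder Δ := LinearOrder.lift' e e.injective
  let m : MonomialOrder Δ := MonomialOrder.lex
  let x : Fin t.card → B := fun j => t.equivFin.symm j
  have hx : Set.range x = t := by
    rw [Set.range_comp' Subtype.val, t.equivFin.symm.range_eq_univ, Set.image_univ,
      Subtype.range_coe]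
  exact (isRanking_derFamily m x).genericallyOpen hinj hdiff
    (adjoin_range_derFamily m hdiff (hx ▸ ht)) (wellQuasiOrdered_foldr_derShift m)

theorem exists_mul_mem_radical_of_mem_minimalPrimes {R : Type*} [CommRing R] {I q : Ideal R}
    (hq : q ∈ I.minimalPrimes) {x : R} (hx : x ∈ q) : ∃ y ∉ q, y * x ∈ I.radical := by
  have := hq.isPrime
  have hx' := Ideal.mem_map_of_mem (algebraMap R (Localization.AtPrime q)) hx
  rw [← IsLocalization.AtPrime.radical_map_of_mem_minimalPrimes _ q I hq,
    ← IsLocalization.map_radical q.primeCompl,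
    IsLocalization.algebraMap_mem_map_algebraMap_iff q.primeCompl] at hx'
  exact hx'

section DifferentialIdeal

variable {Δ R : Type*} [CommRing R] [Algebra ℚ R]

theorem pow_mul_derivation_pow_mem {D : Derivation ℤ R R} {I : Ideal R} (hI : ∀ x ∈ I, D x ∈ I)
    {x : R} {n k : ℕ} (h : x ^ (n + 1) * D x ^ k ∈ I) : x ^ n * D x ^ (k + 2) ∈ I := by
  have hunit : IsUnit ((n + 1 : ℕ) : R) := by
    rw [← map_natCast (algebraMap ℚ R)]
    exact (IsUnit.mk0 _ (Nat.cast_ne_zero.2 n.succ_ne_zero)).map _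
  rw [← I.unit_mul_mem_iff_mem hunit]
  have hder := I.mul_mem_left (D x) (hI _ h)
  convert I.sub_mem hder (I.mul_mem_left (k * D (D x)) h) using 1
  rw [D.leibniz, D.leibniz_pow, D.leibniz_pow]
  obtain _ | k := k
  · simp only [smul_eq_mul, nsmul_eq_mul, Nat.cast_zero, Nat.add_sub_cancel]
    ring
  · simp only [smul_eq_mul, nsmul_eq_mul, Nat.add_sub_cancel]
    ring

theorem derivation_mem_radical {D : Derivation ℤ R R} {I : Ideal R} (hI : ∀ x ∈ I, D x ∈ I)
    {x : R} (hx : x ∈ I.radical) : D x ∈ I.radical := by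
  obtain ⟨n, hn⟩ := hx
  have key (m : ℕ) (hm : m ≤ n) : x ^ (n - m) * D x ^ (2 * m) ∈ I := by
    induction m with
    | zero => rwa [Nat.sub_zero, mul_zero, pow_zero, mul_one]
    | succ m ih =>
      refine pow_mul_derivation_pow_mem hI ?_
      rw [Nat.sub_add_eq, Nat.sub_add_cancel (Nat.sub_pos_of_lt hm)]
      exact ih (Nat.le_of_succ_le hm)
  have h := key n le_rfl
  rw [Nat.sub_self, pow_zero, one_mul] at h
  exact ⟨2 * n, h⟩

theorem IsDeltaIdeal.radical [DeltaRing Δ R] {I : Ideal R} (hI : IsDeltaIdeal Δ I) :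
    IsDeltaIdeal Δ I.radical :=
  fun i _ hx => derivation_mem_radical (hI i) hx

theorem IsDeltaIdeal.of_mem_minimalPrimes [DeltaRing Δ R] {I q : Ideal R}
    (hI : IsDeltaIdeal Δ I) (hq : q ∈ I.minimalPrimes) : IsDeltaIdeal Δ q := by
  intro i x hx
  have hqp := hq.isPrime
  obtain ⟨y, hy, hyx⟩ := exists_mul_mem_radical_of_mem_minimalPrimes hq hx
  have hder : y * DeltaRing.der i x + x * DeltaRing.der i y ∈ I.radical := by
    have h := hI.radical i _ hyx
    rwa [Derivation.leibniz] at h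
  have hle : I.radical ≤ q := hqp.radical_le_iff.2 hq.le
  have hmem := (q.add_mem_iff_left (q.mul_mem_right _ hx)).1 (hle hder)
  exact (hqp.mem_or_mem hmem).resolve_left hy

end DifferentialIdeal

theorem IsDeltaIdeal.map {Δ R S : Type*} [CommRing R] [CommRing S] [DeltaRing Δ R]
    [DeltaRing Δ S] {f : R →+* S} (hf : IsDeltaHom Δ f) {I : Ideal R} (hI : IsDeltaIdeal Δ I) :
    IsDeltaIdeal Δ (I.map f) := by
  intro i x hx
  induction hx using Submodule.span_induction with
  | mem x hx =>
    obtain ⟨a, ha, rfl⟩ := hx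
    rw [← hf]
    exact Ideal.mem_map_of_mem f (hI i a ha)
  | zero => rw [map_zero]; exact zero_mem _
  | add x y _ _ hx hy => rw [map_add]; exact add_mem hx hy
  | smul r x hx' hx =>
    rw [smul_eq_mul, Derivation.leibniz]
    exact add_mem (Ideal.mul_mem_left _ _ hx) (Ideal.mul_mem_right _ _ hx')

theorem DeltaSpec.image_comap_preimage_val {Δ R S : Type*} [CommRing R] [CommRing S] [Algebra ℚ S]
    [DeltaRing Δ R] [DeltaRing Δ S] {f : R →+* S} (hf : IsDeltaHom Δ f)
    {V : Set (PrimeSpectrum S)} (hV : IsOpen V) :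
    DeltaSpec.comap f hf '' (Subtype.val ⁻¹' V) =
      Subtype.val ⁻¹' (PrimeSpectrum.comap f '' V) := by
  ext p
  constructor
  · rintro ⟨q, hq, rfl⟩
    exact ⟨q.1, hq, rfl⟩
  · rintro ⟨q, hq, hqp⟩
    have hle : p.1.asIdeal.map f ≤ q.asIdeal := by
      rw [Ideal.map_le_iff_le_comap, ← hqp]
      rfl
    obtain ⟨q', hq', hle'⟩ := Ideal.exists_minimalPrimes_le hle
    let r : DeltaSpec Δ S := ⟨⟨q', hq'.isPrime⟩, (p.2.map hf).of_mem_minimalPrimes hq'⟩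
    refine ⟨r, ((PrimeSpectrum.le_iff_specializes r.1 q).1 hle').mem_open hV hq,
      Subtype.ext (PrimeSpectrum.ext (le_antisymm ?_ ?_))⟩
    · rw [← hqp]
      exact Ideal.comap_mono hle'
    · exact Ideal.map_le_iff_le_comap.1 hq'.le

theorem DeltaSpec.isOpenMap_comap {Δ R S : Type*} [CommRing R] [CommRing S] [Algebra ℚ S]
    [DeltaRing Δ R] [DeltaRing Δ S] {f : R →+* S} (hf : IsDeltaHom Δ f)
    (h : IsOpenMap (PrimeSpectrum.comap f)) : IsOpenMap (DeltaSpec.comap f hf) := by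
  rintro _ ⟨V, hV, rfl⟩
  rw [DeltaSpec.image_comap_preimage_val hf hV]
  exact (h V hV).preimage continuous_subtype_val

theorem mainTheorem4_general {Δ : Type*} [Finite Δ] {A B : Type*} [CommRing A] [CommRing B]
    [Algebra ℚ B] [DeltaRing Δ A] [DeltaRing Δ B]
    [Algebra A B] (hinj : Function.Injective (algebraMap A B))
    (hdiff : IsDeltaHom Δ (algebraMap A B))
    [IsDomain B] (hfg : DeltaFiniteType Δ A B) :
    ∃ s : B, s ≠ 0 ∧
      IsOpenMap (DeltaSpec.comap
        ((algebraMap B (Localization.Away s)).comp (algebraMap A B))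
        ((isDeltaHom_algebraMap_localization Δ (Submonoid.powers s)).comp hdiff)) := by
  have : CharZero B := algebraRat.charZero B
  obtain ⟨s, hs, hopen⟩ :=
    (genericallyOpen_of_deltaFiniteType hinj hdiff hfg).exists_isOpenMap_comap_localizationAway
  exact ⟨s, hs, DeltaSpec.isOpenMap_comap _ hopen⟩

theorem mainTheorem4 {Δ : Type*} [Finite Δ] {A B : Type*} [CommRing A] [CommRing B]
    [Algebra ℚ A] [Algebra ℚ B] [DeltaRing Δ A] [DeltaRing Δ B]
    [Algebra A B] (hinj : Function.Injective (algebraMap A B))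
    (hdiff : IsDeltaHom Δ (algebraMap A B))
    [IsDomain B] (hfg : DeltaFiniteType Δ A B)
    [TopologicalSpace.NoetherianSpace (DeltaSpec Δ A)] :
    ∃ s : B, s ≠ 0 ∧
      IsOpenMap (DeltaSpec.comap
        ((algebraMap B (Localization.Away s)).comp (algebraMap A B))
        ((isDeltaHom_algebraMap_localization Δ (Submonoid.powers s)).comp hdiff)) :=
  mainTheorem4_general hinj hdiff hfg
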